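/- Let $S\subset\mathbb{N}^q$ be an affine semigroup with minimal generating set $\{a_1,\ldots,a_h\}$ (the $a_i$ pairwise distinct), let $\mathbb{K}$ be a field, and let $$I_S=\Big\langle X^\alpha-X^\beta \;\Big|\; \alpha,\beta\in\mathbb{N}^h,\ \sum_{i=1}^h\alpha_i a_i=\sum_{i=1}^h\beta_i a_i\Big\rangle\subset\mathbb{K}[x_1,\ldots,x_h]$$ be its semigroup ideal, where $X^\alpha=x_1^{\alpha_1}\cdots x_h^{\alpha_h}$. A binomial (a polynomial with exactly two terms) belonging to $I_S$ is called indispensable if every generating set of $I_S$ that consists of binomials contains a nonzero scalar multiple of it. Let $\Lambda=(\lambda_1,\ldots,\lambda_h)$ be a tuple of positive integers such that, for every $k$, there are $\alpha_{k,i}\in\mathbb{N}$ with $\lambda_k a_k=\sum_{i\neq k}\alpha_{k,i}a_i$, and put $$\mathcal{D}''(\Lambda)=\{\gamma\in\mathbb{N}^h \mid \gamma_i\le 2\lambda_i \text{ for all } i\}.$$ Let $\gamma\in\mathcal{D}''(\Lambda)$ be such that $\sum_{i=1}^h\gamma_i a_i$ has exactly two factorizations, that is, there are exactly two $\mu\in\mathbb{N}^h$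 with $\sum_{i=1}^h\mu_i a_i=\sum_{i=1}^h\gamma_i a_i$. Then there exist $\gamma'\in\mathcal{D}''(\Lambda)$ and $\delta,\alpha,\beta\in\mathbb{N}^h$ such that $$X^\gamma-X^{\gamma'}=X^\delta\,(X^\alpha-X^\beta)$$ and $X^\alpha-X^\beta$ is an indispensable binomial of $I_S$. -/

import Mathlib

namespace AffineSemigroup

open MvPolynomial

variable {q h : ℕ}

/-- `{a₁, …, a_h}` is the minimal generating set of the affine semigroup `S ⊆ ℕ^q`, listed
without repetitions: it generates `S`, and no proper subset of it does. -/
structure IsMinimalGeneratingFamily (S : AddSubmonoid (Fin q → ℕ)) (a : Fin h → Fin q → ℕ) :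
    Prop where
  injective : Function.Injective a
  closure_eq : AddSubmonoid.closure (Set.range a) = S
  minimal : ∀ T : Set (Fin q → ℕ), T ⊂ Set.range a → AddSubmonoid.closure T ≠ S

/-- The `S`-degree `∑ αᵢ aᵢ` of the monomial `X^α`. -/
def sDegree (a : Fin h → Fin q → ℕ) (α : Fin h →₀ ℕ) : Fin q → ℕ :=
  ∑ i, α i • a i

/-- The set `Z_n(S)` of factorizations of `n` with respect to the generators `a₁, …, a_h`. -/
def factorizations (a : Fin h → Fin q → ℕ) (n : Fin q → ℕ) : Set (Fin h →₀ ℕ) :=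
  {l | n = sDegree a l}

/-- The monomial `X^α` of `K[x₁, …, x_h]`. -/
noncomputable def xpow (K : Type*) [Field K] (α : Fin h →₀ ℕ) : MvPolynomial (Fin h) K :=
  monomial α 1

/-- The semigroup ideal `I_S`, generated by all `X^α - X^β` with `∑ αᵢ aᵢ = ∑ βᵢ aᵢ`. -/
noncomputable def semigroupIdeal (K : Type*) [Field K] (a : Fin h → Fin q → ℕ) :
    Ideal (MvPolynomial (Fin h) K) :=
  Ideal.span {f | ∃ α β : Fin h →₀ ℕ, sDegree a α = sDegree a β ∧ f = xpow K α - xpow K β}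

/-- A binomial is a polynomial with exactly two terms (with arbitrary nonzero coefficients). -/
def IsBinomial {K : Type*} [Field K] (f : MvPolynomial (Fin h) K) : Prop :=
  f.support.card = 2

/-- An indispensable binomial of `I`: a binomial of `I` a nonzero scalar multiple of which
belongs to every generating set of `I` consisting of binomials. -/
def IsIndispensable {K : Type*} [Field K] (I : Ideal (MvPolynomial (Fin h) K))
    (f : MvPolynomial (Fin h) K) : Prop :=
  IsBinomial f ∧ f ∈ I ∧
    ∀ G : Set (MvPolynomial (Fin h) K), (∀ g ∈ G, IsBinomial g) → Ideal.span G = I →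
      ∃ c : K, c ≠ 0 ∧ c • f ∈ G

/-- The tuple `Λ = (λ₁, …, λ_h)`: for every `k` the multiplier `λ_k` is positive and `λ_k a_k` is a
combination, with coefficients in `ℕ`, of the generators other than `a_k`. -/
def IsMultiplierTuple (a : Fin h → Fin q → ℕ) (Λ : Fin h → ℕ) : Prop :=
  ∀ k, 0 < Λ k ∧ ∃ c : Fin h → ℕ, Λ k • a k = ∑ i ∈ Finset.univ.erase k, c i • a i

/-- The box `D''(Λ) = {γ ∈ ℕ^h | γᵢ ≤ 2 λᵢ}`. -/
def boxTwo (Λ : Fin h → ℕ) : Set (Fin h →₀ ℕ) :=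
  {γ | ∀ i, γ i ≤ 2 * Λ i}

end AffineSemigroup

namespace AffineSemigroup

open MvPolynomial

/-! Let `γ'` be the other factorization. Cancelling the common factor `X^(γ ⊓ γ')` leaves coprime
monomials that are again the only ones of their degree, since multiplying back lands in `{γ, γ'}`.
Such a pair is indispensable (`isIndispensable_of_factorizations_eq_pair`): in a binomial generating
set without a multiple of it, no monomial multiple of a generator involves `X^α`. Finally `γ'` lies
in the box, because an exponent above `2 * Λ k` allows two successive exchanges, hence a third
factorization. -/

lemma sDegree_add {q h : ℕ} (a : Fin h → Fin q → ℕ) (α β : Fin h →₀ ℕ) :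
    sDegree a (α + β) = sDegree a α + sDegree a β := by
  simp [sDegree, add_smul, Finset.sum_add_distrib]

/-- The homomorphism of `K`-algebras `K[x₁, …, x_h] → K[ℕ^q]` that sends `X^α` to its `S`-degree. -/
noncomputable def degreeMap (K : Type*) [Field K] {q h : ℕ} (a : Fin h → Fin q → ℕ) :
    MvPolynomial (Fin h) K →ₐ[K] AddMonoidAlgebra K (Fin q → ℕ) :=
  aeval fun i => AddMonoidAlgebra.of K (Fin q → ℕ) (Multiplicative.ofAdd (a i))

lemma degreeMap_monomial {K : Type*} [Field K] {q h : ℕ} (a : Fin h → Fin q → ℕ)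
    (α : Fin h →₀ ℕ) (c : K) :
    degreeMap K a (monomial α c) = AddMonoidAlgebra.single (sDegree a α) c := by
  have hprod : (α.prod fun i k =>
      AddMonoidAlgebra.of K (Fin q → ℕ) (Multiplicative.ofAdd (a i)) ^ k) =
      AddMonoidAlgebra.of K (Fin q → ℕ) (Multiplicative.ofAdd (sDegree a α)) := by
    rw [Finsupp.prod_fintype _ _ (by simp), sDegree, ofAdd_sum, map_prod]
    simp only [ofAdd_nsmul, map_pow]
  rw [degreeMap, aeval_monomial, hprod, ← Algebra.smul_def]
  simp [AddMonoidAlgebra.of_apply]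

/-- This forces the two terms of a binomial of `I_S` to cancel in `K[ℕ^q]`: equal degrees, opposite
coefficients. -/
lemma degreeMap_eq_zero {K : Type*} [Field K] {q h : ℕ} (a : Fin h → Fin q → ℕ)
    {p : MvPolynomial (Fin h) K} (hp : p ∈ semigroupIdeal K a) : degreeMap K a p = 0 := by
  have hle : semigroupIdeal K a ≤ RingHom.ker (degreeMap K a) := by
    refine Ideal.span_le.2 ?_
    rintro _ ⟨α, β, hαβ, rfl⟩
    simp [RingHom.mem_ker, xpow, degreeMap_monomial, hαβ]
  exact hle hp

/-- A binomial of `I_S` is a scalar multiple of a difference of monomials of equal `S`-degree,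
either of whose terms may be listed first. -/
lemma exists_eq_smul_of_isBinomial {K : Type*} [Field K] {q h : ℕ} (a : Fin h → Fin q → ℕ)
    {g : MvPolynomial (Fin h) K} (hb : IsBinomial g) (hg : g ∈ semigroupIdeal K a)
    {μ : Fin h →₀ ℕ} (hμ : coeff μ g ≠ 0) :
    ∃ ν, ν ≠ μ ∧ sDegree a ν = sDegree a μ ∧ g = coeff μ g • (xpow K μ - xpow K ν) := by
  have hμs : μ ∈ g.support := mem_support_iff.2 hμ
  obtain ⟨ν, hν⟩ : ∃ ν, g.support.erase μ = {ν} := by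
    rw [← Finset.card_eq_one, Finset.card_erase_of_mem hμs, hb]
  have hνμ : ν ≠ μ := Finset.ne_of_mem_erase (hν ▸ Finset.mem_singleton_self ν)
  have hsum : g = monomial μ (coeff μ g) + monomial ν (coeff ν g) := by
    conv_lhs => rw [← support_sum_monomial_coeff g, ← Finset.add_sum_erase _ _ hμs, hν,
      Finset.sum_singleton]
  have hzero : AddMonoidAlgebra.single (sDegree a μ) (coeff μ g) +
      AddMonoidAlgebra.single (sDegree a ν) (coeff ν g) = 0 := by
    rw [← degreeMap_monomial, ← degreeMap_monomial, ← map_add, ← hsum]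
    exact degreeMap_eq_zero a hg
  have hdeg : sDegree a ν = sDegree a μ := by
    by_contra hne
    have := congrArg (fun p : AddMonoidAlgebra K (Fin q → ℕ) => p.coeff (sDegree a μ)) hzero
    simp [hne, hμ] at this
  have hcoeff : coeff ν g = -coeff μ g := by
    rw [hdeg, ← AddMonoidAlgebra.single_add, AddMonoidAlgebra.single_eq_zero] at hzero
    exact eq_neg_of_add_eq_zero_right hzero
  refine ⟨ν, hνμ, hdeg, ?_⟩
  conv_lhs => rw [hsum, hcoeff]
  simp [xpow, smul_monomial, sub_eq_add_neg]

/-- Two coprime monomials that are the only ones of their `S`-degree form an indispensable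
binomial. -/
lemma isIndispensable_of_factorizations_eq_pair {K : Type*} [Field K] {q h : ℕ}
    (a : Fin h → Fin q → ℕ) {α β : Fin h →₀ ℕ} (hne : α ≠ β) (hdisj : α ⊓ β = 0)
    (hdeg : sDegree a α = sDegree a β)
    (honly : ∀ μ, sDegree a μ = sDegree a α → μ = α ∨ μ = β) :
    IsIndispensable (semigroupIdeal K a) (xpow K α - xpow K β) := by
  have hmem : xpow K α - xpow K β ∈ semigroupIdeal K a :=
    Ideal.subset_span ⟨α, β, hdeg, rfl⟩
  have hcoeff : coeff α (xpow K α - xpow K β) = 1 := by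
    simp [xpow, coeff_monomial, hne.symm]
  refine ⟨?_, hmem, fun G hG hspan => ?_⟩
  · have hsupp : (xpow K α - xpow K β).support = {α, β} := by
      ext μ
      by_cases h1 : α = μ
      · subst h1; simp [xpow, coeff_monomial, hne.symm]
      · by_cases h2 : β = μ
        · subst h2; simp [xpow, coeff_monomial, hne]
        · simp [xpow, coeff_monomial, h1, h2, Ne.symm h1, Ne.symm h2]
    rw [IsBinomial, hsupp, Finset.card_pair hne]
  · by_contra hcon
    have hmul : ∀ g ∈ G, ∀ p : MvPolynomial (Fin h) K, coeff α (p * g) = 0 := by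
      intro g hgG p
      induction p using MvPolynomial.induction_on' with
      | add p₁ p₂ h₁ h₂ => rw [add_mul, coeff_add, h₁, h₂, add_zero]
      | monomial ε c =>
        rw [coeff_monomial_mul']
        split_ifs with hε
        swap; · rfl
        by_contra h0
        have hc : coeff (α - ε) g ≠ 0 := right_ne_zero_of_mul h0
        obtain ⟨ν, hνne, hνdeg, hgeq⟩ := exists_eq_smul_of_isBinomial a (hG g hgG)
          (hspan ▸ Ideal.subset_span hgG) hc
        -- `X^ε` times the second term of `g` has the degree of `X^α` but differs from it.
        have hνε : ν + ε = β := by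
          refine (honly (ν + ε) ?_).resolve_left fun h => hνne ?_
          · rw [sDegree_add, hνdeg, ← sDegree_add, tsub_add_cancel_of_le hε]
          · rw [← h, add_tsub_cancel_right]
        -- `X^ε` divides both `X^α` and `X^β`, which are coprime.
        have hε0 : ε = 0 :=
          le_antisymm (hdisj ▸ le_inf hε (hνε ▸ le_add_self)) zero_le
        subst hε0
        rw [add_zero] at hνε
        subst hνε
        rw [tsub_zero] at hc hgeq
        exact hcon ⟨coeff α g, hc, hgeq ▸ hgG⟩
    have hall : ∀ p ∈ Ideal.span G, coeff α p = 0 := by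
      intro p hp
      refine Submodule.closure_induction (p := fun p _ => coeff α p = 0) ?_ ?_ ?_ hp
      · simp
      · intro x y _ _ hx hy
        rw [coeff_add, hx, hy, add_zero]
      · intro r g hg
        exact hmul g hg r
    exact one_ne_zero (hcoeff.symm.trans (hall _ (hspan.symm ▸ hmem)))

/-- A monomial outside the box `D''(Λ)` has an `S`-degree with at least three factorizations. -/
lemma mem_boxTwo_of_factorizations_subset_pair {q h : ℕ} (a : Fin h → Fin q → ℕ)
    {Λ : Fin h → ℕ} (hΛ : IsMultiplierTuple a Λ) {μ ν : Fin h →₀ ℕ}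
    (honly : ∀ ξ, sDegree a ξ = sDegree a ν → ξ = μ ∨ ξ = ν) : ν ∈ boxTwo Λ := by
  intro k
  by_contra! hk
  obtain ⟨hpos, c, hc⟩ := hΛ k
  -- The relation for `k` may assign any value to `c k`; setting it to zero makes each exchange
  -- lower the `k`-th exponent by exactly `Λ k`.
  let r : Fin h →₀ ℕ := Finsupp.equivFunOnFinite.symm fun i => if i = k then 0 else c i
  have hrk : r k = 0 := by simp [r]
  have hr : sDegree a r = sDegree a (Finsupp.single k (Λ k)) := by
    have hsingle : sDegree a (Finsupp.single k (Λ k)) = Λ k • a k := by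
      simp [sDegree, Finsupp.single_apply, ite_smul]
    rw [hsingle, hc, sDegree, ← Finset.add_sum_erase _ _ (Finset.mem_univ k), hrk, zero_smul,
      zero_add]
    refine Finset.sum_congr rfl fun i hi => ?_
    simp [r, Finset.ne_of_mem_erase hi]
  obtain ⟨ρ, rfl⟩ : ∃ ρ, ν = ρ + Finsupp.single k (Λ k) + Finsupp.single k (Λ k) := by
    refine ⟨ν - Finsupp.single k (2 * Λ k), ?_⟩
    rw [add_assoc, ← Finsupp.single_add, ← two_mul, tsub_add_cancel_of_le]
    exact Finsupp.single_le_iff.2 hk.le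
  -- With `ν`, these have `k`-th exponents `ρ k + 2 * Λ k`, `ρ k + Λ k` and `ρ k`, distinct as `Λ k
  -- > 0`.
  have h₁ := honly (ρ + r + Finsupp.single k (Λ k)) (by simp only [sDegree_add, hr])
  have h₂ := honly (ρ + r + r) (by simp only [sDegree_add, hr])
  have key : ∀ {ξ η : Fin h →₀ ℕ}, ξ = η → ξ k = η k := fun h => by rw [h]
  rcases h₁ with h₁ | h₁
  · rcases h₂ with h₂ | h₂
    · have := key (h₁.trans h₂.symm)
      simp [hrk] at this
      omega
    · have := key h₂
      simp [hrk] at this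
      omega
  · have := key h₁
    simp [hrk] at this
    omega

end AffineSemigroup

theorem mainTheorem8 {K : Type*} [Field K] {q h : ℕ}
    (S : AddSubmonoid (Fin q → ℕ)) (a : Fin h → Fin q → ℕ)
    (hS : AffineSemigroup.IsMinimalGeneratingFamily S a)
    (Λ : Fin h → ℕ) (hΛ : AffineSemigroup.IsMultiplierTuple a Λ)
    (γ : Fin h →₀ ℕ) (hγ : γ ∈ AffineSemigroup.boxTwo Λ)
    (hZ : (AffineSemigroup.factorizations a (AffineSemigroup.sDegree a γ)).ncard = 2) :
    ∃ γ' ∈ AffineSemigroup.boxTwo Λ, ∃ δ α β : Fin h →₀ ℕ,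
      AffineSemigroup.xpow K γ - AffineSemigroup.xpow K γ' =
          AffineSemigroup.xpow K δ * (AffineSemigroup.xpow K α - AffineSemigroup.xpow K β) ∧
        AffineSemigroup.IsIndispensable (AffineSemigroup.semigroupIdeal K a)
          (AffineSemigroup.xpow K α - AffineSemigroup.xpow K β) := by
  obtain ⟨μ, ν, hμν, hpair⟩ := Set.ncard_eq_two.1 hZ
  have hγmem : γ ∈ AffineSemigroup.factorizations a (AffineSemigroup.sDegree a γ) := rfl
  obtain ⟨γ', hne, hset⟩ : ∃ γ', γ ≠ γ' ∧
      AffineSemigroup.factorizations a (AffineSemigroup.sDegree a γ) = {γ, γ'} := by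
    rcases hpair ▸ hγmem with h | h
    · exact ⟨ν, h ▸ hμν, by rw [hpair, h]⟩
    · rw [Set.mem_singleton_iff] at h
      exact ⟨μ, h ▸ hμν.symm, by rw [hpair, h, Set.pair_comm]⟩
  have hdeg : AffineSemigroup.sDegree a γ = AffineSemigroup.sDegree a γ' := by
    have : γ' ∈ AffineSemigroup.factorizations a (AffineSemigroup.sDegree a γ) := by
      rw [hset]; simp
    exact this
  have honly : ∀ ξ, AffineSemigroup.sDegree a ξ = AffineSemigroup.sDegree a γ →
      ξ = γ ∨ ξ = γ' := by
    intro ξ hξ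
    have : ξ ∈ AffineSemigroup.factorizations a (AffineSemigroup.sDegree a γ) := hξ.symm
    rwa [hset] at this
  have hα : γ ⊓ γ' + (γ - γ ⊓ γ') = γ := add_tsub_cancel_of_le inf_le_left
  have hβ : γ ⊓ γ' + (γ' - γ ⊓ γ') = γ' := add_tsub_cancel_of_le inf_le_right
  refine ⟨γ', AffineSemigroup.mem_boxTwo_of_factorizations_subset_pair a hΛ
    (fun ξ hξ => honly ξ (hξ.trans hdeg.symm)), γ ⊓ γ', γ - γ ⊓ γ', γ' - γ ⊓ γ', ?_,
    AffineSemigroup.isIndispensable_of_factorizations_eq_pair a ?_ ?_ ?_ ?_⟩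
  · simp only [AffineSemigroup.xpow, mul_sub, MvPolynomial.monomial_mul, one_mul, hα, hβ]
  · intro h
    exact hne (by rw [← hα, h, hβ])
  · ext i
    simp only [Finsupp.inf_apply, Finsupp.tsub_apply, Finsupp.coe_zero, Pi.zero_apply]
    omega
  · refine add_left_cancel (a := AffineSemigroup.sDegree a (γ ⊓ γ')) ?_
    rw [← AffineSemigroup.sDegree_add, ← AffineSemigroup.sDegree_add, hα, hβ, hdeg]
  · intro ξ hξ
    have h := honly (γ ⊓ γ' + ξ) (by
      rw [AffineSemigroup.sDegree_add, hξ, ← AffineSemigroup.sDegree_add, hα])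
    exact h.imp (fun h => add_left_cancel (h.trans hα.symm))
      (fun h => add_left_cancel (h.trans hβ.symm))
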